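/- Let \(L\) be a locally compact Hausdorff space with a continuous surjection \(\varphi:L\to\omega_1\) all of whose fibres are finite (\(\omega_1\) with the order topology), let \(L_\alpha=\{x\in L:\varphi(x)<\alpha\}\) for \(\alpha<\omega_1\), and let \(K=L\cup\{\infty\}\) be the one-point compactification of \(L\). Put \(\partial K^n=\{x\in K^n: x_i=\infty\text{ for some }i\}\), \(\Delta(K^n)=\{x\in K^n:|\{x_1,\dots,x_n\}|<n\}\), and call \(x,y\in K^n\) disjoint if \(\{x_1,\dots,x_n\}\cap\{y_1,\dots,y_n\}=\emptyset\). For a partition \((I_1,\dots,I_k)\) of \(\{1,\dots,m\}\) into nonempty sets, a set \(C\subseteq L^m\) is called \((I_1,\dots,I_k)\)-separated if, writing \(G_j(x)=\{x_i:i\in I_j\}\), for each \(j\) the cardinality of \(G_j(x)\) is the same for all \(x\in C\), and \(G_j(x)\cap G_i(x')=\emptyset\) for all \(x,x'\in C\) and all \(i,j\) with \(i\ne j\) or \(x\ne x'\). Assume that \(L\) has the collapsing property: for all \(m\ge 1\) and every partition \((I_1,\dots,I_k)\) of \(\{1,\dots,m\}\), every uncountable \((I_1,\dots,I_k)\)-separated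 set \(C\subseteq L^m\) has an accumulation point \(q\in K^m\) such that, for some distinct \(a_1,\dots,a_k\in K\) with \(a_k=\infty\), one has \(\{q_i:i\in I_j\}=\{a_j\}\) for all \(1\le j\le k\). Let \(n\ge 1\), let \(C_0(L^n)\) be identified with the space of continuous functions \(K^n\to\mathbb R\) that vanish on \(\partial K^n\), and let \(M_0(K^n)=C_0(L^n)^*\) be the space of signed Radon measures \(\mu\) of finite variation on \(K^n\) with \(|\mu|(\partial K^n)=0\), with the weak\(^*\) topology induced by \(C_0(L^n)\). Let \(\nu:K^n\to M_0(K^n)\), \(x\mapsto\nu_x\), be weak\(^*\) continuous with \(\nu_x=0\) for all \(x\in\partial K^n\). Then: 1. Let \(\mathcal A\subseteq L^n\) be an uncountable set of pairwise disjoint points, and let \(I_1,\dots,I_k\) be a partition of \(\{1,\dots,n\}\) such that for every \(y\in\mathcal A\) and all \(s,t\), \(y_s=y_t\) if and only if \(s,t\in I_i\) for some \(i\). Then there are \(r\in\mathbb R\) and a countable set \(\mathcal A_0\subseteq\mathcal A\) such that \(\nu_y(\{y\})=r\) for all \(y\in\mathcal A\setminus\mathcal A_0\). 2. There are \(r\in\mathbb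 R\) and \(\rho<\omega_1\) such that \(\nu_y(\{y\})=r\) for all \(y\in(L\setminus L_\rho)^n\setminus\Delta(K^n)\). -/

import Mathlib

open MeasureTheory Topology Filter

namespace CollapsingSpace

/-- The set of countable ordinals, i.e. the ordinal `ω₁` as a set of ordinals, with its order
topology. -/
abbrev CountableOrdinal : Type 1 := Set.Iio (Ordinal.omega.{0} 1)

/-- `K ^ n` with the product topology, where `K = L ∪ {∞}` is the one-point compactification
of `L`. -/
abbrev KPow (L : Type*) (n : ℕ) : Type _ := Fin n → OnePoint L

section Points

variable {L : Type*} {n : ℕ}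

/-- The inclusion of `L ^ n` in `K ^ n`. -/
def incl (x : Fin n → L) : KPow L n := fun i => (x i : OnePoint L)

/-- The support `{x₁, …, xₙ}` of a point of `K ^ n`. -/
def supp (x : KPow L n) : Set (OnePoint L) := Set.range x

/-- Two points of `K ^ n` are disjoint if their supports are. -/
def DisjointPoints (x y : KPow L n) : Prop := Disjoint (supp x) (supp y)

variable (L n) in
/-- The generalized diagonal of `K ^ n`. -/
def genDiagonal : Set (KPow L n) := {x | (supp x).ncard < n}

variable (L n) in
/-- The boundary of `K ^ n`: the points with some coordinate equal to `∞`. -/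
def bdry : Set (KPow L n) := {x | OnePoint.infty ∈ supp x}

end Points

section CollapsingProperty

/-- `I₁, …, I_k` is a partition of `{1, …, m}` (into nonempty parts). -/
def IsPartition {k m : ℕ} (I : Fin k → Set (Fin m)) : Prop :=
  (∀ j, (I j).Nonempty) ∧ (Pairwise fun i j => Disjoint (I i) (I j)) ∧ ⋃ j, I j = Set.univ

/-- A family `λ ↦ (G₁^λ, …, G_k^λ)` of `k`-tuples of subsets of `L` is `k`-separated: for some
nonzero natural numbers `c₁, …, c_k` the set `G_j^λ` always has exactly `c_j` elements, and
`G_j^λ ∩ G_i^γ = ∅` whenever `i ≠ j` or `λ ≠ γ`. -/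
def KSeparated {L Γ : Type*} {k : ℕ} (G : Γ → Fin k → Set L) : Prop :=
  (∃ c : Fin k → ℕ, (∀ j, c j ≠ 0) ∧ ∀ l j, (G l j).ncard = c j) ∧
    ∀ l l' j i, (i ≠ j ∨ l ≠ l') → Disjoint (G l j) (G l' i)

/-- A set `C ⊆ L ^ m` is `(I₁, …, I_k)`-separated if the family of the tuples
`({x_i : i ∈ I₁}, …, {x_i : i ∈ I_k})`, `x ∈ C`, is `k`-separated. -/
def Separated {L : Type*} {k m : ℕ} (I : Fin k → Set (Fin m)) (C : Set (Fin m → L)) : Prop :=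
  KSeparated fun (x : C) (j : Fin k) => x.1 '' I j

/-- The set `C ⊆ L ^ m` collapses with respect to the partition `I` (whose last part is
distinguished): it has an accumulation point `q ∈ K ^ m` such that `{q_i : i ∈ I_j} = {a_j}` for
some distinct points `a_j` of `K`, the last of which is `∞`. -/
def Collapses {L : Type*} [TopologicalSpace L] {k m : ℕ} (I : Fin (k + 1) → Set (Fin m))
    (C : Set (Fin m → L)) : Prop :=
  ∃ q : KPow L m, AccPt q (𝓟 (incl '' C)) ∧
    ∃ a : Fin (k + 1) → OnePoint L, Function.Injective a ∧ a (Fin.last k) = OnePoint.infty ∧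
      ∀ j, q '' I j = {a j}

/-- The collapsing property of a (locally compact Hausdorff) space `L`. -/
def CollapsingProperty (L : Type*) [TopologicalSpace L] : Prop :=
  ∀ (m k : ℕ) (I : Fin (k + 1) → Set (Fin m)), 1 ≤ m → IsPartition I →
    ∀ C : Set (Fin m → L), ¬ C.Countable → Separated I C → Collapses I C

end CollapsingProperty

/-- The set `L_α = φ⁻¹[α] = {x ∈ L : φ x < α}` for `α < ω₁`. -/
def initialPart {L : Type*} (φ : L → CountableOrdinal) (α : CountableOrdinal) : Set L :=
  {x | φ x < α}

section Measures

variable (L : Type*) [TopologicalSpace L] (n : ℕ)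

/-- `K ^ n` carries the Borel σ-algebra of the product topology (in general larger than the
product of the Borel σ-algebras of the factors). -/
instance instMeasurableSpaceKPow : MeasurableSpace (KPow L n) := borel _

instance instBorelSpaceKPow : BorelSpace (KPow L n) := ⟨rfl⟩

/-- `M₀(K ^ n)`: the signed Radon measures `μ` on `K ^ n` with `|μ|(∂ K ^ n) = 0`. -/
structure M0 where
  /-- The underlying signed Borel measure (automatically of finite variation). -/
  toSignedMeasure : SignedMeasure (KPow L n)
  regular : toSignedMeasure.totalVariation.Regular
  bdry_null : toSignedMeasure.totalVariation (bdry L n) = 0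

/-- `C₀(L ^ n)`, identified with the continuous real functions on `K ^ n` that vanish on the
boundary. -/
def C0 : Type _ := {f : C(KPow L n, ℝ) // ∀ x ∈ bdry L n, f x = 0}

variable {L n}

/-- The integral of a function against an element of `M₀(K ^ n)`, through the Jordan
decomposition. -/
noncomputable def M0.integral (μ : M0 L n) (f : C0 L n) : ℝ :=
  (∫ x, f.1 x ∂μ.toSignedMeasure.toJordanDecomposition.posPart) -
    ∫ x, f.1 x ∂μ.toSignedMeasure.toJordanDecomposition.negPart

/-- The weak* topology on `M₀(K ^ n) = C₀(L ^ n)*`: the coarsest topology that makes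
`μ ↦ ∫ f dμ` continuous for every `f ∈ C₀(L ^ n)`. -/
noncomputable instance instTopologicalSpaceM0 : TopologicalSpace (M0 L n) :=
  TopologicalSpace.induced (fun μ f => μ.integral f) (Pi.topologicalSpace (Y := fun _ : C0 L n => ℝ))

/-- `ν : K ^ n → M₀(K ^ n)` is weak* continuous and vanishes at infinity, that is, on the
boundary of `K ^ n`. -/
def WeakStarContinuousVanishing (ν : KPow L n → M0 L n) : Prop :=
  Continuous ν ∧ ∀ x ∈ bdry L n, (ν x).toSignedMeasure = 0

/-- The diagonal mass `ν_y({y})`. -/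
noncomputable def diagMass (ν : KPow L n → M0 L n) (y : KPow L n) : ℝ :=
  (ν y).toSignedMeasure {y}

end Measures

end CollapsingSpace

/-! Both assertions say that, among the points with a fixed pattern of equal coordinates, `ν_y({y})`
is constant once the coordinates avoid a suitable countable set. The corresponding filter has the
countable intersection property, so if this failed there would be `r < s` with mass below `r` at
some points and above `s` at others, each kind available off any countable set. This yields
uncountably many pairwise disjoint pairs `(y, z)` of such points.

Compact subsets of `L` are countable, so each `ν_y` lives up to `ε` on `E_y ^ n` with `E_y` finite.
A `Δ`-system argument makes these sets disjoint off a finite root `D`, and discarding countably many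
pairs keeps `y` and `z` out of an open countable set containing `D`. The collapsing property,
applied to the tuples formed by `y`, `z` and the rest of their finite sets off `D`, brings `y` and
`z` close to one point `b` of `L ^ n` while the rest goes to `∞`. A bump function at `b` supported
away from `D` then sees, inside each finite power, only `y` or only `z`. Its integrals against `ν_y`
and `ν_z` nearly equal the two diagonal masses, and by weak* continuity both are close to its
integral against `ν_b`: a contradiction (`not_diagMass_lt_of_lt_of_disjoint`). -/

/-! ### Filters, disjoint subfamilies and `Δ`-systems -/

/-- If a real function cannot be frequently below `r` and frequently above `s` for any `r < s`,
then it is eventually constant along a filter with the countable intersection property. -/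
theorem Filter.exists_eventually_eq_of_not_frequently_lt_of_lt {X : Type*} {F : Filter X}
    [CountableInterFilter F] {g : X → ℝ}
    (h : ∀ r s, r < s → ¬ ((∃ᶠ x in F, g x < r) ∧ ∃ᶠ x in F, s < g x)) :
    ∃ r, ∀ᶠ x in F, g x = r := by
  rcases F.eq_or_neBot with rfl | hF
  · exact ⟨0, by simp⟩
  have h' : ∀ r s, r < s → (∀ᶠ x in F, r ≤ g x) ∨ ∀ᶠ x in F, g x ≤ s := by
    intro r s hrs
    by_contra! hc
    refine h r s hrs ⟨?_, ?_⟩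
    · simpa using hc.1
    · simpa using hc.2
  -- The constant is the supremum of the eventual lower bounds; countable intersections make this
  -- set nonempty and bounded above.
  set P : Set ℝ := {p | ∀ᶠ x in F, p ≤ g x} with hP
  have hne : P.Nonempty := by
    by_contra hc
    rw [Set.not_nonempty_iff_eq_empty] at hc
    have h1 : ∀ k : ℕ, ∀ᶠ x in F, g x ≤ -(k : ℝ) := fun k =>
      (h' (-(k : ℝ) - 1) (-(k : ℝ)) (by linarith)).resolve_left
        (fun hk => (hc ▸ hk : (-(k : ℝ) - 1) ∈ (∅ : Set ℝ)))
    obtain ⟨x, hx⟩ := (eventually_countable_forall.2 h1).exists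
    obtain ⟨k, hk⟩ := exists_nat_gt (-g x)
    linarith [hx k]
  have hbdd : BddAbove P := by
    by_contra hc
    rw [not_bddAbove_iff] at hc
    have h1 : ∀ k : ℕ, ∀ᶠ x in F, (k : ℝ) ≤ g x := fun k => by
      obtain ⟨p, hp, hkp⟩ := hc k
      exact Eventually.mono hp fun x hx => hkp.le.trans hx
    obtain ⟨x, hx⟩ := (eventually_countable_forall.2 h1).exists
    obtain ⟨k, hk⟩ := exists_nat_gt (g x)
    linarith [hx k]
  have hlow : ∀ k : ℕ, ∀ᶠ x in F, sSup P - 1 / ((k : ℝ) + 1) ≤ g x := fun k => by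
    obtain ⟨p, hp, hkp⟩ := exists_lt_of_lt_csSup hne
      (show sSup P - 1 / ((k : ℝ) + 1) < sSup P by
        have : 0 < 1 / ((k : ℝ) + 1) := by positivity
        linarith)
    exact Eventually.mono hp fun x hx => hkp.le.trans hx
  have hup : ∀ k : ℕ, ∀ᶠ x in F, g x ≤ sSup P + 1 / ((k : ℝ) + 1) := fun k => by
    have hpos : 0 < 1 / ((k : ℝ) + 1) := by positivity
    -- Half the increment suffices: an eventual lower bound strictly above `sSup P` is already
    -- impossible.
    refine (h' (sSup P + 1 / ((k : ℝ) + 1) / 2) _ (by linarith)).resolve_left fun hk => ?_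
    have := le_csSup hbdd hk
    linarith
  refine ⟨sSup P, ?_⟩
  filter_upwards [eventually_countable_forall.2 hlow, eventually_countable_forall.2 hup]
    with x h1 h2
  refine le_antisymm (le_of_forall_pos_le_add fun e he => ?_)
    (le_of_forall_pos_le_add fun e he => ?_)
  all_goals
    obtain ⟨k, hk⟩ := exists_nat_one_div_lt he
    linarith [h1 k, h2 k]

/-- A family of countable nonempty sets some member of which avoids any given countable set
contains an uncountable pairwise disjoint subfamily. -/
theorem Set.exists_not_countable_pairwiseDisjoint {ι X : Type*} {S : ι → Set X} {A : Set ι}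
    (hne : ∀ i ∈ A, (S i).Nonempty) (hc : ∀ i ∈ A, (S i).Countable)
    (h : ∀ T : Set X, T.Countable → ∃ i ∈ A, Disjoint (S i) T) :
    ∃ B ⊆ A, ¬ B.Countable ∧ B.PairwiseDisjoint S := by
  -- A maximal disjoint subfamily works: if it were countable, so would be its union, and a member
  -- avoiding that union could be added.
  obtain ⟨B, hB⟩ := zorn_subset {B : Set ι | B ⊆ A ∧ B.PairwiseDisjoint S} (by
    intro c hc1 hc2
    refine ⟨⋃₀ c, And.intro (Set.sUnion_subset fun s hs => (hc1 hs).1) ?_,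
      fun s hs => Set.subset_sUnion_of_mem hs⟩
    exact (Set.pairwiseDisjoint_sUnion hc2.directedOn).2 fun s hs => (hc1 hs).2)
  refine ⟨B, hB.prop.1, fun hBc => ?_, hB.prop.2⟩
  obtain ⟨i, hi, hdis⟩ := h (⋃ j ∈ B, S j) (hBc.biUnion fun j hj => hc j (hB.prop.1 hj))
  have hins : insert i B ∈ {B : Set ι | B ⊆ A ∧ B.PairwiseDisjoint S} := by
    refine ⟨Set.insert_subset hi hB.prop.1, hB.prop.2.insert fun j hj _ => ?_⟩
    exact hdis.mono_right (Set.subset_biUnion_of_mem (u := S) hj)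
  have hiB : i ∈ B := hB.le_of_ge hins (Set.subset_insert i B) (Set.mem_insert i B)
  obtain ⟨x, hx⟩ := hne i hi
  exact Set.disjoint_left.1 hdis hx (Set.mem_biUnion hiB hx)

/-- A labelling of an uncountable set by a countable type is constant on an
uncountable subset. -/
theorem Set.exists_not_countable_fiber {ι κ : Type*} [Countable κ] {A : Set ι}
    (hA : ¬ A.Countable) (f : ι → κ) : ∃ c, ¬ {i ∈ A | f i = c}.Countable := by
  by_contra! h
  exact hA ((Set.countable_iUnion h).mono fun i hi =>
    Set.mem_iUnion.2 (show ∃ c, i ∈ {i ∈ A | f i = c} from ⟨f i, hi, rfl⟩))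

/-- The `Δ`-system lemma for uncountable families of finite sets of bounded cardinality. -/
theorem Finset.exists_deltaSystem_of_card_le {ι X : Type*} [DecidableEq X] (p : ℕ) :
    ∀ (S : ι → Finset X) (A : Set ι), ¬ A.Countable → (∀ i ∈ A, (S i).card ≤ p) →
      ∃ B ⊆ A, ¬ B.Countable ∧ ∃ D : Finset X, B.PairwiseDisjoint fun i => S i \ D := by
  induction p with
  | zero =>
    refine fun S A hA hS => ⟨A, subset_rfl, hA, ∅, fun i hi j hj _ => ?_⟩
    have h0 : S i = ∅ := Finset.card_eq_zero.1 (Nat.le_zero.1 (hS i hi))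
    simp [Function.onFun, h0]
  | succ p ih =>
    intro S A hA hS
    -- A point in uncountably many sets goes into the root and is erased. Otherwise each countable
    -- set meets only countably many members, and the root can be empty.
    by_cases hx : ∃ x, ¬ {i ∈ A | x ∈ S i}.Countable
    · obtain ⟨x, hx⟩ := hx
      obtain ⟨B, hBA, hB, D, hD⟩ := ih (fun i => (S i).erase x) _ hx (fun i hi => by
        have := hS i hi.1
        rw [Finset.card_erase_of_mem hi.2]
        omega)
      refine ⟨B, fun i hi => (hBA hi).1, hB, insert x D, fun i hi j hj hij => ?_⟩
      have := hD hi hj hij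
      simp only [Function.onFun] at this ⊢
      convert this using 1 <;> · ext; simp; tauto
    · push Not at hx
      by_cases hem : ¬ {i ∈ A | S i = ∅}.Countable
      · refine ⟨_, fun i hi => hi.1, hem, ∅, fun i hi j hj _ => ?_⟩
        simp [Function.onFun, hi.2]
      push Not at hem
      obtain ⟨B, hBA, hB, hd⟩ := Set.exists_not_countable_pairwiseDisjoint
        (S := fun i => (S i : Set X)) (A := {i ∈ A | (S i).Nonempty})
        (fun i hi => Finset.coe_nonempty.2 hi.2)
        (fun i _ => (S i).countable_toSet) (fun T hT => by
          by_contra! hc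
          refine hA ((hem.union (hT.biUnion fun x _ => hx x)).mono fun i hi => ?_)
          by_cases h0 : S i = ∅
          · exact Or.inl ⟨hi, h0⟩
          · obtain ⟨x, hxS, hxT⟩ := Set.not_disjoint_iff.1 (hc i ⟨hi, Finset.nonempty_iff_ne_empty.2 h0⟩)
            exact Or.inr (Set.mem_biUnion hxT ⟨hi, hxS⟩))
      refine ⟨B, fun i hi => (hBA hi).1, hB, ∅, fun i hi j hj hij => ?_⟩
      simpa [Function.onFun] using hd hi hj hij

/-- The `Δ`-system lemma for uncountable families of finite sets. -/
theorem Finset.exists_deltaSystem {ι X : Type*} [DecidableEq X] (S : ι → Finset X) {A : Set ι}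
    (hA : ¬ A.Countable) :
    ∃ B ⊆ A, ¬ B.Countable ∧ ∃ D : Finset X, B.PairwiseDisjoint fun i => S i \ D := by
  obtain ⟨c, hc⟩ := Set.exists_not_countable_fiber hA fun i => (S i).card
  obtain ⟨B, hBA, hB⟩ := Finset.exists_deltaSystem_of_card_le c S _ hc fun i hi => hi.2.le
  exact ⟨B, fun i hi => (hBA hi).1, hB⟩

/-! ### Countable and compact subsets of `L` -/

namespace CollapsingSpace

section Countability

theorem exists_bound_of_countable {T : Set CountableOrdinal} (hT : T.Countable) :
    ∃ ρ, ∀ x ∈ T, x < ρ := by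
  have := hT.to_subtype
  have h1 : ⨆ i : T, (i.1 : Ordinal) < Ordinal.omega 1 :=
    Ordinal.iSup_lt_omega_one fun i => i.1.2
  refine ⟨⟨Order.succ (⨆ i : T, (i.1 : Ordinal)),
    (Cardinal.isSuccLimit_omega 1).succ_lt h1⟩, fun x hx => ?_⟩
  rw [← Subtype.coe_lt_coe, Order.lt_succ_iff]
  exact Ordinal.le_iSup (fun i : T => (i.1 : Ordinal)) ⟨x, hx⟩

theorem countable_Iio_countableOrdinal (ρ : CountableOrdinal) : (Set.Iio ρ).Countable := by
  have h : (Set.Iio (ρ : Ordinal)).Countable := by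
    rw [← Cardinal.le_aleph0_iff_set_countable, ← Cardinal.lt_aleph_one_iff, Cardinal.mk_Iio_ordinal]
    have := ρ.2
    have h2 : (ρ : Ordinal).card < Cardinal.aleph 1 := by
      rw [Cardinal.lt_ord.symm, Cardinal.ord_aleph]
      exact this
    simpa using Cardinal.lift_lt.2 h2
  refine (h.preimage_of_injOn Subtype.val_injective.injOn).mono fun x hx => ?_
  exact hx

variable {L : Type*} {φ : L → CountableOrdinal}

theorem countable_initialPart (hφ : ∀ α, (φ ⁻¹' {α}).Finite) (ρ : CountableOrdinal) :
    (initialPart φ ρ).Countable := by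
  refine ((countable_Iio_countableOrdinal ρ).biUnion fun α _ => (hφ α).countable).mono ?_
  exact fun x hx => Set.mem_biUnion (x := φ x) hx rfl

theorem isOpen_initialPart [TopologicalSpace L] (hφ : Continuous φ) (ρ : CountableOrdinal) :
    IsOpen (initialPart φ ρ) := isOpen_Iio.preimage hφ

theorem exists_subset_initialPart {T : Set L} (φ : L → CountableOrdinal) (hT : T.Countable) :
    ∃ ρ, T ⊆ initialPart φ ρ := by
  obtain ⟨ρ, hρ⟩ := exists_bound_of_countable (hT.image φ)
  exact ⟨ρ, fun x hx => hρ _ (Set.mem_image_of_mem φ hx)⟩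

/-- The image in `ω₁` is compact, hence bounded, and initial parts of `L` are countable because the
fibres are finite. -/
theorem _root_.IsCompact.countable_of_continuous_countableOrdinal [TopologicalSpace L]
    (hφ : Continuous φ) (hfin : ∀ α, (φ ⁻¹' {α}).Finite) {H : Set L} (hH : IsCompact H) :
    H.Countable := by
  have : Nonempty CountableOrdinal := ⟨⟨0, Ordinal.omega_pos 1⟩⟩
  obtain ⟨b, hb⟩ := (hH.image hφ).bddAbove
  obtain ⟨ρ, hρ⟩ := exists_bound_of_countable (Set.countable_singleton b)
  exact (countable_initialPart hfin ρ).mono fun x hx =>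
    lt_of_le_of_lt (hb (Set.mem_image_of_mem φ hx)) (hρ b rfl)

end Countability

end CollapsingSpace

/-! ### Finite boxes in `K ^ n` and approximation of measures -/

namespace CollapsingSpace

section Incl

variable {L : Type*} {n : ℕ}

theorem incl_injective : Function.Injective (incl : (Fin n → L) → KPow L n) :=
  fun _ _ h => funext fun i => OnePoint.coe_injective (congrFun h i)

theorem exists_incl_eq_of_notMem_bdry {x : KPow L n} (hx : x ∉ bdry L n) :
    ∃ w : Fin n → L, incl w = x := by
  have h : ∀ i, ∃ w : L, (w : OnePoint L) = x i := fun i =>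
    OnePoint.ne_infty_iff_exists.1 fun hi => hx ⟨i, hi⟩
  choose w hw using h
  exact ⟨w, funext hw⟩

theorem isClosed_bdry [TopologicalSpace L] : IsClosed (bdry L n) := by
  have : bdry L n = ⋃ i, (fun x : KPow L n => x i) ⁻¹' {OnePoint.infty} := by
    ext x
    simp [bdry, supp]
  rw [this]
  exact isClosed_iUnion_of_finite fun i => OnePoint.isClosed_infty.preimage (continuous_apply i)

/-- The points of `L ^ n` with all coordinates in `E`, as a subset of `K ^ n`. -/
def inclBox (n : ℕ) (E : Set L) : Set (KPow L n) := incl '' {w | ∀ i, w i ∈ E}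

theorem incl_mem_inclBox {E : Set L} {w : Fin n → L} : incl w ∈ inclBox n E ↔ ∀ i, w i ∈ E :=
  incl_injective.mem_set_image

theorem inclBox_mono {E F : Set L} (h : E ⊆ F) : inclBox n E ⊆ inclBox n F :=
  Set.image_mono fun _ hw i => h (hw i)

theorem finite_inclBox {E : Set L} (hE : E.Finite) : (inclBox n E).Finite :=
  (Set.Finite.pi' fun _ => hE).image _

end Incl

section Measures

variable {L : Type*} [TopologicalSpace L] {n : ℕ}

theorem inclBox_measurableSet [T1Space L] {E : Set L} (hE : E.Finite) :
    MeasurableSet (inclBox n E) := (finite_inclBox hE).isClosed.measurableSet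

/-- Off the boundary, every coordinate projection of a compact set is a compact subset of `L`, hence
countable. -/
theorem exists_countable_subset_inclBox {φ : L → CountableOrdinal} (hφ : Continuous φ)
    (hfin : ∀ α, (φ ⁻¹' {α}).Finite) {H : Set (KPow L n)} (hH : IsCompact H)
    (hHb : H ⊆ (bdry L n)ᶜ) : ∃ T : Set L, T.Countable ∧ H ⊆ inclBox n T := by
  have hc : ∀ i : Fin n, ((fun y : L => (y : OnePoint L)) ⁻¹'
      ((fun x : KPow L n => x i) '' H)).Countable := fun i => by
    refine IsCompact.countable_of_continuous_countableOrdinal hφ hfin ?_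
    refine (OnePoint.isOpenEmbedding_coe.isInducing.isCompact_preimage_iff ?_).2
      (hH.image (continuous_apply i))
    rintro _ ⟨x, hx, rfl⟩
    obtain ⟨w, rfl⟩ := exists_incl_eq_of_notMem_bdry (hHb hx)
    exact ⟨w i, rfl⟩
  refine ⟨_, Set.countable_iUnion hc, fun x hx => ?_⟩
  obtain ⟨w, rfl⟩ := exists_incl_eq_of_notMem_bdry (hHb hx)
  exact incl_mem_inclBox.2 fun i => Set.mem_iUnion.2 ⟨i, incl w, hx, rfl⟩

/-- An element of `M₀(K ^ n)` is concentrated, up to `ε`, on the `n`-th power of a finite subset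
of `L`. -/
theorem M0.exists_finset_totalVariation_lt [T2Space L] [LocallyCompactSpace L]
    {φ : L → CountableOrdinal} (hφ : Continuous φ)
    (hfin : ∀ α, (φ ⁻¹' {α}).Finite) [Nonempty L] (μ : M0 L n) {ε : ENNReal} (hε : ε ≠ 0) :
    ∃ E : Finset L, μ.toSignedMeasure.totalVariation (inclBox n (E : Set L))ᶜ < ε := by
  classical
  set τ := μ.toSignedMeasure.totalVariation with hτ
  have := μ.regular
  -- As the boundary is null, regularity puts all but `ε` of the mass on a compact `H` off it;
  -- finite boxes exhaust a countable box containing `H`.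
  obtain ⟨H, hHb, hH, hHε⟩ := (isClosed_bdry (L := L) (n := n)).isOpen_compl.measurableSet
    |>.exists_isCompact_sdiff_lt (μ := τ) (measure_ne_top _ _) hε
  obtain ⟨T, hT, hHT⟩ := exists_countable_subset_inclBox hφ hfin hH hHb
  obtain ⟨f, hf⟩ := Set.countable_iff_exists_subset_range.1 hT
  set E : ℕ → Finset L := fun N => (Finset.range N).image f with hE
  have hmono : Monotone E := fun a b hab => Finset.image_subset_image (Finset.range_mono hab)
  have hlim : Tendsto (fun N => τ (inclBox n (E N : Set L))ᶜ) atTop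
      (𝓝 (τ (⋂ N, (inclBox n (E N : Set L))ᶜ))) := by
    refine tendsto_measure_iInter_atTop
      (fun N => (inclBox_measurableSet (E N).finite_toSet).compl.nullMeasurableSet)
      (fun a b hab => Set.compl_subset_compl.2 (inclBox_mono ?_)) ⟨0, measure_ne_top _ _⟩
    exact_mod_cast hmono hab
  have hlt : τ (⋂ N, (inclBox n (E N : Set L))ᶜ) < ε := by
    have hsub : (⋂ N, (inclBox n (E N : Set L))ᶜ) ⊆ ((bdry L n)ᶜ \ H) ∪ bdry L n := by
      intro x hx
      by_cases hxb : x ∈ bdry L n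
      · exact Or.inr hxb
      refine Or.inl ⟨hxb, fun hxH => ?_⟩
      obtain ⟨w, hw, rfl⟩ := hHT hxH
      choose m hm using fun i => hf (hw i)
      have hN : incl w ∈ inclBox n (E (Finset.univ.sup m + 1) : Set L) := by
        refine incl_mem_inclBox.2 fun i => ?_
        simp only [hE, Finset.coe_image, Finset.coe_range]
        exact ⟨m i, Nat.lt_succ_of_le (Finset.le_sup (f := m) (Finset.mem_univ i)), hm i⟩
      exact Set.mem_iInter.1 hx _ hN
    calc τ (⋂ N, (inclBox n (E N : Set L))ᶜ) ≤ τ ((bdry L n)ᶜ \ H) + τ (bdry L n) :=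
          (measure_mono hsub).trans (measure_union_le _ _)
      _ < ε := by rwa [hτ, μ.bdry_null, add_zero]
  obtain ⟨N, hN⟩ := (hlim.eventually (gt_mem_nhds hlt)).exists
  exact ⟨E N, hN⟩

/-- On `B` the function is the indicator of `{x}`, so the error is the integral over `Bᶜ`, where `f`
is at most `1`. -/
theorem abs_integral_sub_measureReal_le {X : Type*} [TopologicalSpace X] [CompactSpace X]
    [T1Space X] [MeasurableSpace X] [BorelSpace X] (m : Measure X) [IsFiniteMeasure m] (f : C(X, ℝ))
    (hf : ∀ x, f x ∈ Set.Icc (0 : ℝ) 1) {B : Set X} (hB : MeasurableSet B) {x : X} (hx : x ∈ B)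
    (hfx : f x = 1) (hfB : ∀ z ∈ B, z ≠ x → f z = 0) :
    |∫ z, f z ∂m - m.real {x}| ≤ m.real Bᶜ := by
  have hint : Integrable f m := by
    refine Integrable.of_bound f.continuous.aestronglyMeasurable 1 (ae_of_all _ fun z => ?_)
    rw [Real.norm_eq_abs, abs_of_nonneg (hf z).1]
    exact (hf z).2
  have h1 : ∫ z in B, f z ∂m = m.real {x} := by
    rw [← integral_indicator_one (measurableSet_singleton x), ← integral_indicator hB]
    congr 1
    ext z
    by_cases hz : z = x
    · subst hz
      simp [hx, hfx]
    · by_cases hzB : z ∈ B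
      · simp [hzB, hz, hfB z hzB hz]
      · simp [hzB, hz]
  rw [← integral_add_compl hB hint, h1, add_sub_cancel_left]
  rw [← Real.norm_eq_abs]
  refine (norm_setIntegral_le_of_norm_le_const (C := 1) (measure_lt_top _ _) fun z _ => ?_).trans
    (by simp)
  rw [Real.norm_eq_abs, abs_of_nonneg (hf z).1]
  exact (hf z).2

theorem M0.abs_integral_sub_le [T1Space L] (μ : M0 L n) (f : C0 L n) (hf : ∀ x, f.1 x ∈ Set.Icc (0 : ℝ) 1)
    {B : Set (KPow L n)} (hB : MeasurableSet B) {x : KPow L n} (hx : x ∈ B) (hfx : f.1 x = 1)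
    (hfB : ∀ z ∈ B, z ≠ x → f.1 z = 0) :
    |μ.integral f - μ.toSignedMeasure {x}| ≤ μ.toSignedMeasure.totalVariation.real Bᶜ := by
  rw [M0.integral, SignedMeasure.apply_eq_posPart_real_sub_negPart_real _
    (measurableSet_singleton x), SignedMeasure.totalVariation, measureReal_add_apply]
  have h1 := abs_integral_sub_measureReal_le μ.toSignedMeasure.toJordanDecomposition.posPart f.1
    hf hB hx hfx hfB
  have h2 := abs_integral_sub_measureReal_le μ.toSignedMeasure.toJordanDecomposition.negPart f.1
    hf hB hx hfx hfB
  rw [abs_le] at *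
  constructor <;> linarith

theorem WeakStarContinuousVanishing.continuous_integral {ν : KPow L n → M0 L n}
    (hν : WeakStarContinuousVanishing ν) (f : C0 L n) :
    Continuous fun x => (ν x).integral f :=
  (continuous_apply f).comp (continuous_induced_rng.1 hν.1)

end Measures

/-! ### Collapsing for indexed families, and the filter of co-countable coordinates -/

section Collapsing

variable {L : Type*} [TopologicalSpace L]

/-- The collapsing property for families of points indexed by a finite type, whose coordinates
are partitioned by a map `cls`. -/
theorem CollapsingProperty.exists_cluster (hL : CollapsingProperty L) {J Γ : Type*} [Fintype J]
    {k : ℕ} {cls : J → Fin (k + 1)} (hcls : Function.Surjective cls) (hΓ : Uncountable Γ)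
    (x : Γ → J → L) (hx : ∀ i j s t, x i s = x j t → i = j ∧ cls s = cls t) :
    ∃ a : Fin (k + 1) → OnePoint L, Function.Injective a ∧ a (Fin.last k) = OnePoint.infty ∧
      ∀ U ∈ 𝓝 (fun s => a (cls s)), ∃ i, (fun s => (x i s : OnePoint L)) ∈ U := by
  classical
  set e : J ≃ Fin (Fintype.card J) := Fintype.equivFin J
  set I : Fin (k + 1) → Set (Fin (Fintype.card J)) := fun j => {s | cls (e.symm s) = j} with hI
  have hJ : Nonempty J := ⟨(hcls 0).choose⟩
  have hpart : IsPartition I := by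
    refine ⟨fun j => ?_, fun i j hij => Set.disjoint_left.2 fun s hs ht => hij (hs.symm.trans ht),
      Set.eq_univ_of_forall fun s => Set.mem_iUnion.2 ⟨_, rfl⟩⟩
    obtain ⟨s, hs⟩ := hcls j
    exact ⟨e s, by simpa [hI] using hs⟩
  set X : Γ → Fin (Fintype.card J) → L := fun i s => x i (e.symm s) with hX
  have hXinj : Function.Injective X := fun i j hij =>
    (hx i j hJ.some hJ.some (by simpa [hX] using congrFun hij (e hJ.some))).1
  -- Separatedness requires each block to have constant cardinality, which holds on an uncountable
  -- subfamily.
  obtain ⟨c, hc⟩ := Set.exists_not_countable_fiber (A := (Set.univ : Set Γ))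
    (Set.not_countable_univ_iff.2 hΓ) fun i (j : Fin (k + 1)) => (X i '' I j).ncard
  set A : Set Γ := {i ∈ Set.univ | (fun j => (X i '' I j).ncard) = c} with hA
  have hC : ¬ (X '' A).Countable := fun h => hc (Set.countable_of_injective_of_countable_image hXinj.injOn h)
  have hsep : Separated I (X '' A) := by
    refine ⟨⟨c, ?_, ?_⟩, ?_⟩
    · intro j
      obtain ⟨i, hi⟩ : A.Nonempty := Set.nonempty_iff_ne_empty.2 fun h => hc (h ▸ Set.countable_empty)
      rw [← hi.2]
      have : (X i '' I j).Nonempty := (hpart.1 j).image _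
      exact (Set.ncard_pos (Set.toFinite _)).2 this |>.ne'
    · rintro ⟨_, i, hi, rfl⟩ j
      exact congrFun hi.2 j
    · rintro ⟨_, i, hi, rfl⟩ ⟨_, i', hi', rfl⟩ j j' hne
      rw [Set.disjoint_left]
      rintro _ ⟨s, hs, rfl⟩ ⟨t, ht, hst⟩
      obtain ⟨h1, h2⟩ := hx _ _ _ _ hst
      rcases hne with h | h
      · exact h (ht.symm.trans (h2.trans hs))
      · exact h (by simp [h1])
  obtain ⟨q, hq, a, ha, hlast, hqa⟩ := hL _ k I (Fintype.card_pos) hpart _ hC hsep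
  have hq' : ∀ s, q s = a (cls (e.symm s)) := fun s => by
    have : q s ∈ q '' I (cls (e.symm s)) := ⟨s, rfl, rfl⟩
    rwa [hqa] at this
  refine ⟨a, ha, hlast, fun U hU => ?_⟩
  have hcont : Continuous fun (z : KPow L (Fintype.card J)) (s : J) => z (e s) := by fun_prop
  have hpre : (fun (z : KPow L (Fintype.card J)) (s : J) => z (e s)) ⁻¹' U ∈ 𝓝 q := by
    refine hcont.continuousAt.preimage_mem_nhds ?_
    simpa [hq'] using hU
  obtain ⟨z, ⟨hzU, _, ⟨i, hi, rfl⟩, rfl⟩, -⟩ := accPt_iff_nhds.1 hq _ hpre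
  refine ⟨i, ?_⟩
  simpa [incl, hX] using hzU

end Collapsing

section AvoidFilter

/-- The filter on `L ^ n` generated by the sets of the points with no coordinate in `T`, for
countable sets `T`. -/
def avoidCountable (L : Type*) (n : ℕ) : Filter (Fin n → L) :=
  Filter.ofCountableInter {s | ∃ T : Set L, T.Countable ∧ ∀ y : Fin n → L, (∀ i, y i ∉ T) → y ∈ s}
    (by
      intro S hS hSl
      choose! T hT hTs using fun s (hs : s ∈ S) => hSl hs
      refine ⟨⋃ s ∈ S, T s, hS.biUnion hT, fun y hy s hs => hTs s hs y fun i hi => ?_⟩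
      exact hy i (Set.mem_biUnion hs hi))
    (by
      rintro s t ⟨T, hT, hTs⟩ hst
      exact ⟨T, hT, fun y hy => hst (hTs y hy)⟩)

instance instCountableInterFilterAvoidCountable (L : Type*) (n : ℕ) :
    CountableInterFilter (avoidCountable L n) := by
  unfold avoidCountable
  infer_instance

theorem eventually_avoidCountable {L : Type*} {n : ℕ} {p : (Fin n → L) → Prop} :
    (∀ᶠ y in avoidCountable L n, p y) ↔
      ∃ T : Set L, T.Countable ∧ ∀ y : Fin n → L, (∀ i, y i ∉ T) → p y := Iff.rfl

end AvoidFilter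

end CollapsingSpace

/-! ### The bump function and the contradiction from collapsing -/

namespace CollapsingSpace

/-- Points near `a` are separated from the other coordinates by a Urysohn function: there are
neighbourhoods `U j` of the points `a j` and `f ∈ C₀(L ^ n)` with values in `[0, 1]`, equal to `1`
near the point `t ↦ a (cls t)` and to `0` off the product of the `U (cls t)`. -/
theorem exists_nhds_and_bump {L : Type*} [TopologicalSpace L] [T2Space L] [LocallyCompactSpace L]
    {n k : ℕ} (cls : Fin n → Fin k) {a : Fin (k + 1) → OnePoint L} (ha : Function.Injective a)
    (hlast : a (Fin.last k) = OnePoint.infty) {D : Set L} (hD : D.Finite)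
    (haD : ∀ j : Fin k, ∀ x ∈ D, a j.castSucc ≠ (x : OnePoint L)) :
    ∃ U : Fin (k + 1) → Set (OnePoint L), (∀ j, U j ∈ 𝓝 (a j)) ∧
      Pairwise (Function.onFun Disjoint U) ∧
      (∀ j : Fin k, ∀ x ∈ D, (x : OnePoint L) ∉ U j.castSucc) ∧
      ∃ f : C0 L n, (∀ x, f.1 x ∈ Set.Icc (0 : ℝ) 1) ∧
        (∃ N ∈ 𝓝 (fun t => a (cls t).castSucc), ∀ x ∈ N, f.1 x = 1) ∧
        ∀ x, f.1 x ≠ 0 → ∀ t, x t ∈ U (cls t).castSucc := by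
  obtain ⟨V, hV, hVd⟩ := Pairwise.exists_mem_filter_of_disjoint (l := fun j => 𝓝 (a j))
    fun i j hij => disjoint_nhds_nhds.2 (ha.ne hij)
  set D' : Set (OnePoint L) := (fun x : L => (x : OnePoint L)) '' D with hD'
  have hD'c : IsClosed D' := (hD.image _).isClosed
  set U : Fin (k + 1) → Set (OnePoint L) := fun j => if j = Fin.last k then V j else V j \ D'
    with hU
  have hUV : ∀ j, U j ⊆ V j := fun j => by
    simp only [hU]
    split_ifs
    · exact subset_rfl
    · exact Set.sdiff_subset
  have hUc : ∀ j : Fin k, U j.castSucc = V j.castSucc \ D' := fun j => by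
    simp [hU, (Fin.castSucc_lt_last j).ne]
  have hUn : ∀ j, U j ∈ 𝓝 (a j) := fun j => by
    induction j using Fin.lastCases with
    | last => simpa [hU] using hV (Fin.last k)
    | cast j =>
      rw [hUc]
      refine inter_mem (hV _) (hD'c.isOpen_compl.mem_nhds ?_)
      rintro ⟨x, hx, hxa⟩
      exact haD j x hx hxa.symm
  have hUd : Pairwise (Function.onFun Disjoint U) := fun i j hij =>
    (hVd hij).mono (hUV i) (hUV j)
  set b : KPow L n := fun t => a (cls t).castSucc with hb
  set P : Set (KPow L n) := Set.pi Set.univ fun t => U (cls t).castSucc with hP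
  have hPb : P ∈ 𝓝 b := set_pi_mem_nhds Set.finite_univ fun t _ => hUn _
  obtain ⟨C, hCb, hC, hCP⟩ := exists_mem_nhds_isClosed_subset (interior_mem_nhds.2 hPb)
  obtain ⟨f, hf0, hf1, hf01⟩ := exists_continuous_zero_one_of_isClosed
    (isOpen_interior (s := P)).isClosed_compl hC (Set.disjoint_left.2 fun x hx hxC => hx (hCP hxC))
  have hfP : ∀ x, f x ≠ 0 → ∀ t, x t ∈ U (cls t).castSucc := fun x hx t => by
    have : x ∈ interior P := by
      by_contra h
      exact hx (hf0 h)
    exact interior_subset this t trivial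
  refine ⟨U, hUn, hUd, fun j x hx hxU => ?_, ⟨f, fun x hx => ?_⟩, hf01, ⟨C, hCb, hf1⟩, hfP⟩
  · rw [hUc] at hxU
    exact hxU.2 ⟨x, hx, rfl⟩
  -- `f` vanishes on the boundary because a coordinate `∞ = a (Fin.last k)` lies in the last
  -- neighbourhood, disjoint from the others.
  · obtain ⟨t, ht⟩ := hx
    by_contra h
    refine Set.disjoint_left.1 (hUd (Fin.castSucc_lt_last (cls t)).ne) (hfP x h t) ?_
    rw [ht, ← hlast]
    exact mem_of_mem_nhds (hUn _)

section Core

variable {L : Type*} [TopologicalSpace L] [T2Space L] [LocallyCompactSpace L]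

/-- The diagonal masses cannot stay apart along two families of points `y i`, `z i` with the same
pattern of equal coordinates, if the sets `E i`, `F i` essentially supporting `ν (y i)` and
`ν (z i)` are pairwise disjoint apart from a finite root `D`. -/
theorem not_diagMass_lt_of_lt_of_disjoint (hL : CollapsingProperty L) {n k : ℕ}
    {ν : KPow L n → M0 L n} (hν : WeakStarContinuousVanishing ν)
    {cls : Fin n → Fin k} (hcls : Function.Surjective cls)
    {Γ : Type*} (hΓ : Uncountable Γ) {y z : Γ → Fin n → L} {d : Γ → L}
    (hyc : ∀ i s t, y i s = y i t ↔ cls s = cls t) (hzc : ∀ i s t, z i s = z i t ↔ cls s = cls t)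
    {E F : Γ → Finset L} {D O : Set L} (hDO : D ⊆ O) (hO : IsOpen O) (hD : D.Finite)
    (hyE : ∀ i t, y i t ∈ E i) (hzF : ∀ i t, z i t ∈ F i)
    (hyO : ∀ i t, y i t ∉ O) (hzO : ∀ i t, z i t ∉ O) (hdD : ∀ i, d i ∉ D)
    (hEE : ∀ i j, i ≠ j → ∀ x ∈ E i, x ∈ E j → x ∈ D)
    (hFF : ∀ i j, i ≠ j → ∀ x ∈ F i, x ∈ F j → x ∈ D)
    (hEF : ∀ i j, ∀ x ∈ E i, x ∈ F j → x ∈ D)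
    (hdE : ∀ i j, d i ∉ E j) (hdF : ∀ i j, d i ∉ F j) (hd : Function.Injective d)
    {r s : ℝ} {ε : ℝ} (hε : 0 < ε)
    (hrs : r + 4 * ε < s)
    (hEν : ∀ i, (ν (incl (y i))).toSignedMeasure.totalVariation.real
      (inclBox n (E i : Set L))ᶜ ≤ ε)
    (hFν : ∀ i, (ν (incl (z i))).toSignedMeasure.totalVariation.real
      (inclBox n (F i : Set L))ᶜ ≤ ε)
    (hy : ∀ i, diagMass ν (incl (y i)) < r) (hz : ∀ i, s < diagMass ν (incl (z i))) : False := by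
  classical
  -- These leftover points will be sent to `∞`. The extra point `d i` keeps the set nonempty, as the
  -- last part of the partition must be.
  set R : Γ → Finset L := fun i => (insert (d i) (E i ∪ F i)).filter fun x =>
    x ∉ D ∧ (∀ t, x ≠ y i t) ∧ ∀ t, x ≠ z i t with hR
  have hdR : ∀ i, d i ∈ R i := fun i => by
    simp only [hR, Finset.mem_filter, Finset.mem_insert, true_or, true_and]
    exact ⟨hdD i, fun t h => hdE i i (h ▸ hyE i t), fun t h => hdF i i (h ▸ hzF i t)⟩
  obtain ⟨c, hc⟩ := Set.exists_not_countable_fiber (A := (Set.univ : Set Γ))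
    (Set.not_countable_univ_iff.2 hΓ) fun i => (R i).card
  set Γ' := {i : Γ // i ∈ {i ∈ Set.univ | (R i).card = c}} with hΓ'
  have hunc : Uncountable Γ' := ⟨fun h => hc (Set.countable_coe_iff.1 h)⟩
  let e : ∀ i : Γ', Fin c ≃ R i.1 := fun i => ((R i.1).equivFinOfCardEq i.2.2).symm
  let x : Γ' → Fin n ⊕ Fin n ⊕ Fin c → L := fun i =>
    Sum.elim (y i.1) (Sum.elim (z i.1) fun l => (e i l : L))
  -- Corresponding coordinates of `y` and `z` share a class, which forces both points towards the
  -- same limit.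
  let C : Fin n ⊕ Fin n ⊕ Fin c → Fin (k + 1) :=
    Sum.elim (fun t => (cls t).castSucc) (Sum.elim (fun t => (cls t).castSucc) fun _ => Fin.last k)
  have hcpos : Nonempty (Fin c) := by
    obtain ⟨i⟩ := (inferInstance : Nonempty Γ')
    exact ⟨(e i).symm ⟨_, hdR i.1⟩⟩
  have hC : Function.Surjective C := fun j => by
    induction j using Fin.lastCases with
    | last => exact ⟨Sum.inr (Sum.inr hcpos.some), rfl⟩
    | cast j =>
      obtain ⟨t, rfl⟩ := hcls j
      exact ⟨Sum.inl t, rfl⟩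
  have hyD : ∀ i t, y i t ∉ D := fun i t h => hyO i t (hDO h)
  have hzD : ∀ i t, z i t ∉ D := fun i t h => hzO i t (hDO h)
  have hRD : ∀ i, ∀ u ∈ R i, u ∉ D := fun i u hu => ((Finset.mem_filter.1 hu).2).1
  have hRy : ∀ i, ∀ u ∈ R i, ∀ t, u ≠ y i t := fun i u hu => ((Finset.mem_filter.1 hu).2).2.1
  have hRz : ∀ i, ∀ u ∈ R i, ∀ t, u ≠ z i t := fun i u hu => ((Finset.mem_filter.1 hu).2).2.2
  have hRm : ∀ i, ∀ u ∈ R i, u = d i ∨ u ∈ E i ∨ u ∈ F i := fun i u hu => by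
    simpa using (Finset.mem_filter.1 hu).1
  have hyy : ∀ i j s t, y i s = y j t → i = j := fun i j s t h => by
    by_contra hij
    exact hyD i s (hEE i j hij _ (hyE i s) (h ▸ hyE j t))
  have hzz : ∀ i j s t, z i s = z j t → i = j := fun i j s t h => by
    by_contra hij
    exact hzD i s (hFF i j hij _ (hzF i s) (h ▸ hzF j t))
  have hyz : ∀ i j s t, y i s ≠ z j t := fun i j s t h =>
    hyD i s (hEF i j _ (hyE i s) (h ▸ hzF j t))
  have hRy' : ∀ i j, ∀ u ∈ R i, ∀ t, u ≠ y j t := fun i j u hu t h => by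
    by_cases hij : i = j
    · exact hRy i u hu t (hij ▸ h)
    have huE : u ∈ E j := h ▸ hyE j t
    rcases hRm i u hu with rfl | h1 | h1
    · exact hdE i j huE
    · exact hRD i u hu (hEE i j hij u h1 huE)
    · exact hRD i u hu (hEF j i u huE h1)
  have hRz' : ∀ i j, ∀ u ∈ R i, ∀ t, u ≠ z j t := fun i j u hu t h => by
    by_cases hij : i = j
    · exact hRz i u hu t (hij ▸ h)
    have huF : u ∈ F j := h ▸ hzF j t
    rcases hRm i u hu with rfl | h1 | h1
    · exact hdF i j huF
    · exact hRD i u hu (hEF i j u h1 huF)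
    · exact hRD i u hu (hFF i j hij u h1 huF)
  have hRR : ∀ i j, ∀ u ∈ R i, u ∈ R j → i = j := fun i j u hu hu' => by
    by_contra hij
    rcases hRm i u hu with h1 | h1 | h1 <;> rcases hRm j u hu' with h2 | h2 | h2
    · exact hij (hd (h1.symm.trans h2))
    · exact hdE i j (h1 ▸ h2)
    · exact hdF i j (h1 ▸ h2)
    · exact hdE j i (h2 ▸ h1)
    · exact hRD i u hu (hEE i j hij u h1 h2)
    · exact hRD i u hu (hEF i j u h1 h2)
    · exact hdF j i (h2 ▸ h1)
    · exact hRD i u hu (hEF j i u h2 h1)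
    · exact hRD i u hu (hFF i j hij u h1 h2)
  have hx : ∀ i j s t, x i s = x j t → i = j ∧ C s = C t := by
    rintro i j (s | s | s) (t | t | t) h
    · have hij : i = j := Subtype.ext (hyy _ _ _ _ h)
      subst hij
      exact ⟨rfl, congrArg Fin.castSucc ((hyc _ _ _).1 h)⟩
    · exact absurd h (hyz _ _ _ _)
    · exact absurd h.symm (hRy' _ _ _ (e j t).2 _)
    · exact absurd h.symm (hyz _ _ _ _)
    · have hij : i = j := Subtype.ext (hzz _ _ _ _ h)
      subst hij
      exact ⟨rfl, congrArg Fin.castSucc ((hzc _ _ _).1 h)⟩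
    · exact absurd h.symm (hRz' _ _ _ (e j t).2 _)
    · exact absurd h (hRy' _ _ _ (e i s).2 _)
    · exact absurd h (hRz' _ _ _ (e i s).2 _)
    · refine ⟨Subtype.ext (hRR _ _ _ (e i s).2 ?_), rfl⟩
      have h' : (e i s : L) = e j t := h
      rw [h']
      exact (e j t).2
  obtain ⟨a, ha, hlast, hclu⟩ := hL.exists_cluster hC hunc x hx
  -- Each `a j.castSucc` is a cluster value of coordinates of the `y i`, which stay out of the open
  -- set `O ⊇ D`.
  have haD : ∀ j : Fin k, ∀ u ∈ D, a j.castSucc ≠ (u : OnePoint L) := by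
    intro j u hu hau
    obtain ⟨t, rfl⟩ := hcls j
    have hopen : IsOpen ((fun v : L => (v : OnePoint L)) '' O) :=
      OnePoint.isOpenEmbedding_coe.isOpenMap _ hO
    have hn : (fun q : Fin n ⊕ Fin n ⊕ Fin c → OnePoint L => q (Sum.inl t)) ⁻¹'
        ((fun v : L => (v : OnePoint L)) '' O) ∈ 𝓝 (fun s => a (C s)) := by
      refine (continuous_apply (Sum.inl t)).continuousAt.preimage_mem_nhds (hopen.mem_nhds ?_)
      exact ⟨u, hDO hu, hau.symm⟩
    obtain ⟨i, v, hv, hvx⟩ := hclu _ hn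
    have hvy : v = y i.1 t := OnePoint.coe_injective hvx
    exact hyO i.1 t (hvy ▸ hv)
  obtain ⟨U, hU, hUd, hUD, f, hf01, ⟨N, hN, hN1⟩, hfU⟩ := exists_nhds_and_bump cls ha hlast hD haD
  set b : KPow L n := fun t => a (cls t).castSucc with hb
  have hcy : Continuous fun q : Fin n ⊕ Fin n ⊕ Fin c → OnePoint L =>
    (fun t => q (Sum.inl t) : KPow L n) := by fun_prop
  have hcz : Continuous fun q : Fin n ⊕ Fin n ⊕ Fin c → OnePoint L =>
    (fun t => q (Sum.inr (Sum.inl t)) : KPow L n) := by fun_prop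
  have hint := (hν.continuous_integral f).continuousAt (x := b)
  have hM : N ∩ {q | |(ν q).integral f - (ν b).integral f| < ε} ∈ 𝓝 b :=
    inter_mem hN (Metric.continuousAt_iff'.1 hint ε hε)
  have hW : Set.pi Set.univ (fun s => U (C s)) ∈ 𝓝 (fun s => a (C s)) :=
    set_pi_mem_nhds Set.finite_univ fun s _ => hU _
  obtain ⟨i, ⟨hiU, hiy⟩, hiz⟩ := hclu _ (inter_mem (inter_mem hW
    (hcy.continuousAt.preimage_mem_nhds (t := N ∩ _) hM))
    (hcz.continuousAt.preimage_mem_nhds (t := N ∩ _) hM))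
  have hUeq : ∀ {p q : Fin (k + 1)} {v : OnePoint L}, v ∈ U p → v ∈ U q → p = q := by
    intro p q v hp hq
    by_contra hpq
    exact Set.disjoint_left.1 (hUd hpq) hp hq
  have hUR : ∀ j : Fin k, ∀ u ∈ R i.1, (u : OnePoint L) ∉ U j.castSucc := fun j u hu huU => by
    have h1 := hiU (Sum.inr (Sum.inr ((e i).symm ⟨u, hu⟩))) trivial
    have h2 : (u : OnePoint L) ∈ U (Fin.last k) := by simpa [x, C] using h1
    exact (Fin.castSucc_lt_last j).ne (hUeq huU h2)
  -- If `f q ≠ 0`, no coordinate of `q` is in `D` or among the leftovers; nor is it a coordinate of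
  -- `z`, since `E ∩ F ⊆ D`. So it is a coordinate of `y`, and disjointness of the `U j` identifies
  -- its class.
  have hfE : ∀ q ∈ inclBox n (E i.1 : Set L), q ≠ incl (y i.1) → f.1 q = 0 := by
    rintro _ ⟨w, hw, rfl⟩ hne
    by_contra hf
    refine hne (congrArg incl (funext fun t => ?_))
    have hwU := hfU _ hf t
    have hwE : w t ∈ E i.1 := hw t
    have hwy : ∃ t', w t = y i.1 t' := by
      by_contra! hcon
      refine hUR _ (w t) (Finset.mem_filter.2 ⟨by simp [hwE], fun hwD => hUD _ _ hwD hwU, hcon,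
        fun t' ht' => ?_⟩) hwU
      exact hzD i.1 t' (hEF i.1 i.1 _ (ht' ▸ hwE) (hzF _ _))
    obtain ⟨t', ht'⟩ := hwy
    have h1 : (y i.1 t' : OnePoint L) ∈ U (cls t').castSucc := hiU (Sum.inl t') trivial
    rw [ht']
    refine (hyc _ _ _).2 (Fin.castSucc_injective _ (hUeq h1 ?_))
    rw [← ht']
    exact hwU
  have hfF : ∀ q ∈ inclBox n (F i.1 : Set L), q ≠ incl (z i.1) → f.1 q = 0 := by
    rintro _ ⟨w, hw, rfl⟩ hne
    by_contra hf
    refine hne (congrArg incl (funext fun t => ?_))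
    have hwU := hfU _ hf t
    have hwF : w t ∈ F i.1 := hw t
    have hwz : ∃ t', w t = z i.1 t' := by
      by_contra! hcon
      refine hUR _ (w t) (Finset.mem_filter.2 ⟨by simp [hwF], fun hwD => hUD _ _ hwD hwU,
        fun t' ht' => ?_, hcon⟩) hwU
      exact hyD i.1 t' (hEF i.1 i.1 _ (hyE _ _) (ht' ▸ hwF))
    obtain ⟨t', ht'⟩ := hwz
    have h1 : (z i.1 t' : OnePoint L) ∈ U (cls t').castSucc := hiU (Sum.inr (Sum.inl t')) trivial
    rw [ht']
    refine (hzc _ _ _).2 (Fin.castSucc_injective _ (hUeq h1 ?_))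
    rw [← ht']
    exact hwU
  have hEi := M0.abs_integral_sub_le (ν (incl (y i.1))) f hf01
    (inclBox_measurableSet (E i.1).finite_toSet) (incl_mem_inclBox.2 (hyE i.1)) (hN1 _ hiy.1) hfE
  have hFi := M0.abs_integral_sub_le (ν (incl (z i.1))) f hf01
    (inclBox_measurableSet (F i.1).finite_toSet) (incl_mem_inclBox.2 (hzF i.1)) (hN1 _ hiz.1) hfF
  have hEε := abs_le.1 (hEi.trans (hEν i.1))
  have hFε := abs_le.1 (hFi.trans (hFν i.1))
  have hy1 : |(ν (incl (y i.1))).integral f - (ν b).integral f| < ε := hiy.2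
  have hz1 : |(ν (incl (z i.1))).integral f - (ν b).integral f| < ε := hiz.2
  have hy2 := abs_lt.1 hy1
  have hz2 := abs_lt.1 hz1
  have hy3 := hy i.1
  have hz3 := hz i.1
  rw [diagMass] at hy3 hz3
  -- Four errors of size `ε`: mass to integral, and integral to the value at `b`, for each of `y`
  -- and `z`.
  linarith [hEε.1, hEε.2, hFε.1, hFε.2, hy2.1, hy2.2, hz2.1, hz2.2]

end Core

end CollapsingSpace

/-! ### Selection of the families and constancy along the filter -/

/-- Each point of `T` lies in at most one member of the family. -/
theorem Set.PairwiseDisjoint.countable_not_disjoint {ι X : Type*} {B : Set ι} {S : ι → Set X}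
    (h : B.PairwiseDisjoint S) {T : Set X} (hT : T.Countable) :
    {i ∈ B | ¬ Disjoint (S i) T}.Countable := by
  refine (hT.biUnion (t := fun x _ => {i ∈ B | x ∈ S i}) fun x _ => ?_).mono fun i hi => ?_
  · refine Set.Subsingleton.countable fun i hi j hj => ?_
    by_contra hij
    exact Set.disjoint_left.1 (h hi.1 hj.1 hij) hi.2 hj.2
  · obtain ⟨x, hx, hxT⟩ := Set.not_disjoint_iff.1 hi.2
    exact Set.mem_biUnion hxT ⟨hi.1, hx⟩

/-- This draws `m` distinct members of an infinite family for each index, without repetition across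
indices. -/
theorem Infinite.nonempty_prod_fin_embedding (α : Type*) [Infinite α] (m : ℕ) :
    Nonempty (α × Fin m ↪ α) := by
  refine Cardinal.le_def _ _ |>.1 ?_
  rw [Cardinal.mk_prod]
  simp only [Cardinal.lift_uzero, Cardinal.mk_fin, Cardinal.lift_natCast]
  exact Cardinal.mul_le_of_le (Cardinal.aleph0_le_mk α) le_rfl
    (Cardinal.natCast_le_aleph0.trans (Cardinal.aleph0_le_mk α))

namespace CollapsingSpace

theorem frequently_avoidCountable_inf_principal {L : Type*} {n : ℕ} {Y : Set (Fin n → L)}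
    {p : (Fin n → L) → Prop} (h : ∃ᶠ y in avoidCountable L n ⊓ 𝓟 Y, p y) {T : Set L}
    (hT : T.Countable) : ∃ y ∈ Y, p y ∧ ∀ i, y i ∉ T := by
  by_contra! hc
  refine h (eventually_inf_principal.2 (eventually_avoidCountable.2 ⟨T, hT, fun y hy hyY hp => ?_⟩))
  obtain ⟨i, hi⟩ := hc y hyY hp
  exact hy i hi

variable {L : Type*} [TopologicalSpace L] [T2Space L] [LocallyCompactSpace L]

/-- The diagonal mass is constant on the points with a given pattern of equal coordinates, off a
countable set of coordinates. -/
theorem exists_eventually_diagMass_eq {φ : L → CountableOrdinal} (hφ : Continuous φ)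
    (hfin : ∀ α, (φ ⁻¹' {α}).Finite) [Nonempty L] (hL : CollapsingProperty L) {n k : ℕ}
    (hn : 1 ≤ n) {ν : KPow L n → M0 L n} (hν : WeakStarContinuousVanishing ν)
    {cls : Fin n → Fin k} (hcls : Function.Surjective cls) {Y : Set (Fin n → L)}
    (hY : ∀ y ∈ Y, ∀ s t, y s = y t ↔ cls s = cls t) :
    ∃ r, ∀ᶠ y in avoidCountable L n ⊓ 𝓟 Y, diagMass ν (incl y) = r := by
  classical
  refine Filter.exists_eventually_eq_of_not_frequently_lt_of_lt ?_
  rintro r s hrs ⟨hr, hs⟩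
  -- With this choice `4 * ε` is half the gap `s - r`.
  set ε : ℝ := (s - r) / 8 with hε
  have hε0 : 0 < ε := by rw [hε]; linarith
  have happ : ∀ w : Fin n → L, ∃ E : Finset L, (∀ t, w t ∈ E) ∧
      (ν (incl w)).toSignedMeasure.totalVariation.real (inclBox n (E : Set L))ᶜ ≤ ε := by
    intro w
    obtain ⟨E, hE⟩ := M0.exists_finset_totalVariation_lt hφ hfin (ν (incl w))
      (ENNReal.ofReal_pos.2 hε0).ne'
    refine ⟨E ∪ Finset.univ.image w, fun t => by simp, ?_⟩
    refine ENNReal.toReal_le_of_le_ofReal hε0.le ((measure_mono ?_).trans hE.le)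
    exact Set.compl_subset_compl.2 (inclBox_mono (by simp))
  choose E hwE hEν using happ
  set A : Set ((Fin n → L) × (Fin n → L)) := {p | (p.1 ∈ Y ∧ diagMass ν (incl p.1) < r) ∧
    p.2 ∈ Y ∧ s < diagMass ν (incl p.2)} with hA
  set S : (Fin n → L) × (Fin n → L) → Set L := fun p => Set.range p.1 ∪ Set.range p.2 with hS
  obtain ⟨B₀, hB₀A, hB₀, hB₀d⟩ := Set.exists_not_countable_pairwiseDisjoint (S := S) (A := A)
    (fun p _ => ⟨p.1 ⟨0, hn⟩, Or.inl ⟨_, rfl⟩⟩)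
    (fun p _ => (Set.countable_range _).union (Set.countable_range _))
    (fun T hT => by
      obtain ⟨y, hyY, hy, hyT⟩ := frequently_avoidCountable_inf_principal hr hT
      obtain ⟨z, hzY, hz, hzT⟩ := frequently_avoidCountable_inf_principal hs hT
      refine ⟨(y, z), ⟨⟨hyY, hy⟩, hzY, hz⟩, Set.disjoint_left.2 ?_⟩
      rintro _ (⟨t, rfl⟩ | ⟨t, rfl⟩)
      · exact hyT t
      · exact hzT t)
  obtain ⟨B₁, hB₁B₀, hB₁, D, hD⟩ := Finset.exists_deltaSystem (fun p => E p.1 ∪ E p.2) hB₀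
  obtain ⟨ρ, hρ⟩ := exists_subset_initialPart φ D.countable_toSet
  set O := initialPart φ ρ with hO
  set B₂ : Set ((Fin n → L) × (Fin n → L)) := {p ∈ B₁ | Disjoint (S p) O} with hB₂
  have hB₂c : ¬ B₂.Countable := fun h => by
    refine hB₁ ((h.union ((hB₀d.subset hB₁B₀).countable_not_disjoint
      (countable_initialPart hfin ρ))).mono fun p hp => ?_)
    by_cases hpO : Disjoint (S p) O
    · exact Or.inl ⟨hp, hpO⟩
    · exact Or.inr ⟨hp, hpO⟩
  have hunc : Uncountable B₂ := ⟨fun h => hB₂c (Set.countable_coe_iff.1 h)⟩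
  -- The finite sets of the two points of one pair may meet off `D`. So `y`, `z` and the extra point
  -- `d` come from three different pairs.
  obtain ⟨e⟩ := Infinite.nonempty_prod_fin_embedding B₂ 3
  have hpA : ∀ p : B₂, p.1 ∈ A := fun p => hB₀A (hB₁B₀ p.2.1)
  have hO1 : ∀ (p : B₂) t, p.1.1 t ∉ O := fun p t =>
    Set.disjoint_left.1 p.2.2 (Or.inl ⟨t, rfl⟩)
  have hO2 : ∀ (p : B₂) t, p.1.2 t ∉ O := fun p t =>
    Set.disjoint_left.1 p.2.2 (Or.inr ⟨t, rfl⟩)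
  have hEd : ∀ {p q : B₂}, p ≠ q → ∀ {x}, x ∈ E p.1.1 ∪ E p.1.2 → x ∈ E q.1.1 ∪ E q.1.2 →
      x ∈ D := by
    intro p q hpq x hxp hxq
    by_contra hx
    exact Finset.disjoint_left.1 (hD p.2.1 q.2.1 (Subtype.coe_injective.ne hpq))
      (Finset.mem_sdiff.2 ⟨hxp, hx⟩) (Finset.mem_sdiff.2 ⟨hxq, hx⟩)
  have hne : ∀ (i j : B₂) (u v : Fin 3), u ≠ v → e (i, u) ≠ e (j, v) := fun i j u v huv h =>
    huv (congrArg Prod.snd (e.injective h))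
  have hne' : ∀ (i j : B₂) (u : Fin 3), i ≠ j → e (i, u) ≠ e (j, u) := fun i j u hij h =>
    hij (congrArg Prod.fst (e.injective h))
  have hl : ∀ {x : L} {p : B₂}, x ∈ E p.1.1 → x ∈ E p.1.1 ∪ E p.1.2 := fun h =>
    Finset.mem_union_left _ h
  have hr' : ∀ {x : L} {p : B₂}, x ∈ E p.1.2 → x ∈ E p.1.1 ∪ E p.1.2 := fun h =>
    Finset.mem_union_right _ h
  refine not_diagMass_lt_of_lt_of_disjoint hL hν hcls hunc
    (y := fun i => (e (i, 0)).1.1) (z := fun i => (e (i, 1)).1.2)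
    (d := fun i => (e (i, 2)).1.1 ⟨0, hn⟩) (E := fun i => E (e (i, 0)).1.1)
    (F := fun i => E (e (i, 1)).1.2) (D := D) (O := O) (r := r) (s := s)
    (fun i => hY _ (hpA _).1.1) (fun i => hY _ (hpA _).2.1) hρ (isOpen_initialPart hφ ρ)
    D.finite_toSet (fun i t => hwE _ t) (fun i t => hwE _ t) (fun i t => hO1 _ t)
    (fun i t => hO2 _ t) (fun i h => hO1 _ _ (hρ h))
    (fun i j hij x h1 h2 => hEd (hne' i j 0 hij) (hl h1) (hl h2))
    (fun i j hij x h1 h2 => hEd (hne' i j 1 hij) (hr' h1) (hr' h2))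
    (fun i j x h1 h2 => hEd (hne i j 0 1 (by decide)) (hl h1) (hr' h2))
    (fun i j h => hO1 _ _ (hρ (hEd (hne i j 2 0 (by decide)) (hl (hwE _ _)) (hl h))))
    (fun i j h => hO1 _ _ (hρ (hEd (hne i j 2 1 (by decide)) (hl (hwE _ _)) (hr' h))))
    (fun i j h => ?_) hε0 (by rw [hε]; linarith) (fun i => hEν _) (fun i => hEν _)
    (fun i => (hpA _).1.2) (fun i => (hpA _).2.2)
  by_contra hij
  simp only at h
  refine hO1 (e (i, 2)) ⟨0, hn⟩ (hρ (hEd (hne' i j 2 hij) (hl (hwE _ _)) (hl ?_)))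
  rw [h]
  exact hwE _ _

end CollapsingSpace

/-! ### The two assertions -/

theorem theorem4p4 {L : Type*} [TopologicalSpace L] [T2Space L] [LocallyCompactSpace L]
    (φ : L → CollapsingSpace.CountableOrdinal) (hφ_cont : Continuous φ)
    (hφ_surj : Function.Surjective φ) (hφ_fin : ∀ α, (φ ⁻¹' {α}).Finite)
    (hL : CollapsingSpace.CollapsingProperty L)
    (n : ℕ) (hn : 1 ≤ n) (ν : CollapsingSpace.KPow L n → CollapsingSpace.M0 L n)
    (hν : CollapsingSpace.WeakStarContinuousVanishing ν) :
    (∀ A : Set (Fin n → L), ¬ A.Countable →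
      (A.Pairwise fun y z =>
        CollapsingSpace.DisjointPoints (CollapsingSpace.incl y) (CollapsingSpace.incl z)) →
      ∀ (k : ℕ) (I : Fin k → Set (Fin n)), CollapsingSpace.IsPartition I →
        (∀ y ∈ A, ∀ s t, y s = y t ↔ ∃ i, s ∈ I i ∧ t ∈ I i) →
        ∃ (r : ℝ) (A₀ : Set (Fin n → L)), A₀ ⊆ A ∧ A₀.Countable ∧
          ∀ y ∈ A \ A₀, CollapsingSpace.diagMass ν (CollapsingSpace.incl y) = r) ∧
    (∃ (r : ℝ) (ρ : CollapsingSpace.CountableOrdinal),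
      ∀ y : Fin n → L, (∀ i, y i ∉ CollapsingSpace.initialPart φ ρ) →
        CollapsingSpace.incl y ∉ CollapsingSpace.genDiagonal L n →
        CollapsingSpace.diagMass ν (CollapsingSpace.incl y) = r) := by
  have : Nonempty L := ⟨(hφ_surj ⟨0, Ordinal.omega_pos 1⟩).choose⟩
  refine ⟨fun A _ hAd k I hI hA => ?_, ?_⟩
  · have hex : ∀ s, ∃ j, s ∈ I j := fun s => Set.mem_iUnion.1 (hI.2.2 ▸ Set.mem_univ s)
    choose cls hcls using hex
    have huniq : ∀ {s j}, s ∈ I j → cls s = j := fun {s j} hs => by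
      by_contra hne
      exact Set.disjoint_left.1 (hI.2.1 hne) (hcls s) hs
    have hsurj : Function.Surjective cls := fun j => (hI.1 j).imp fun s hs => huniq hs
    obtain ⟨r, hr⟩ := CollapsingSpace.exists_eventually_diagMass_eq hφ_cont hφ_fin hL hn hν hsurj
      (Y := A) fun y hy s t => by
        rw [hA y hy]
        exact ⟨fun ⟨i, hs, ht⟩ => (huniq hs).trans (huniq ht).symm,
          fun h => ⟨cls s, hcls s, h ▸ hcls t⟩⟩
    obtain ⟨T, hT, hTr⟩ :=
      CollapsingSpace.eventually_avoidCountable.1 (eventually_inf_principal.1 hr)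
    have hAd' : A.PairwiseDisjoint fun y : Fin n → L => Set.range y := fun y hy z hz hyz => by
      refine Set.disjoint_left.2 ?_
      rintro _ ⟨s, rfl⟩ ⟨t, ht⟩
      exact Set.disjoint_left.1 (hAd hy hz hyz) ⟨s, rfl⟩ ⟨t, congrArg _ ht⟩
    -- The exceptional set consists of the points of `A` with a coordinate in `T`; by disjointness
    -- it is countable.
    refine ⟨r, _, fun y hy => hy.1, hAd'.countable_not_disjoint hT, fun y hy => ?_⟩
    refine hTr y (fun i hi => hy.2 ⟨hy.1, fun hd => ?_⟩) hy.1
    exact Set.disjoint_left.1 hd ⟨i, rfl⟩ hi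
  -- Off the generalized diagonal the coordinates are distinct, so the pattern is the partition into
  -- singletons, given by the identity.
  · obtain ⟨r, hr⟩ := CollapsingSpace.exists_eventually_diagMass_eq hφ_cont hφ_fin hL hn hν
      Function.surjective_id (Y := {y | Function.Injective y}) fun y hy s t => hy.eq_iff
    obtain ⟨T, hT, hTr⟩ :=
      CollapsingSpace.eventually_avoidCountable.1 (eventually_inf_principal.1 hr)
    obtain ⟨ρ, hρ⟩ := CollapsingSpace.exists_subset_initialPart φ hT
    refine ⟨r, ρ, fun y hy hyd => hTr y (fun i hi => hy i (hρ hi)) ?_⟩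
    by_contra hinj
    refine hyd ?_
    have h1 : (Set.range y).ncard < n := by
      by_contra! hge
      refine hinj ?_
      rw [← Set.image_univ] at hge
      have h2 := Set.ncard_image_iff (f := y) (s := Set.univ) |>.1 (le_antisymm
        (Set.ncard_image_le) (by simpa [Set.ncard_univ] using hge))
      exact Set.injOn_univ.1 h2
    have h3 : CollapsingSpace.supp (CollapsingSpace.incl y) =
        (fun x : L => (x : OnePoint L)) '' Set.range y := by
      rw [← Set.range_comp]
      rfl
    show (CollapsingSpace.supp (CollapsingSpace.incl y)).ncard < n
    rw [h3, Set.ncard_image_of_injective _ OnePoint.coe_injective]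
    exact h1
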